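/- Let $q$ be an odd prime power and let $\psi:\mathbb F_q\to\mathbb C^\times$ be a non-trivial additive character. Let $(U,\beta)$ be a two-dimensional $\mathbb F_q$-vector space with a non-degenerate symmetric bilinear form, let $V=\mathbb F_q^2$ with the symplectic form $\langle v,v'\rangle_V=v_1v_2'-v_2v_1'$, and equip $W=U\otimes V$ with the symplectic form $\langle\,,\rangle=\beta\otimes\langle\,,\rangle_V$. Let $\mathrm{Heis}(W)=W\times\mathbb F_q$ be the Heisenberg group, with the law $(w,z)(w',z')=(w+w',z+z'+\tfrac12\langle w,w'\rangle)$, on which $Sp(W)$ acts by $g(w,z)=(gw,z)$. A Heisenberg representation is an irreducible complex representation $\pi$ of $\mathrm{Heis}(W)$ such that every $(0,z)$ acts as the scalar $\psi(z)$; an oscillator representation is a representation $\omega=\omega_{U\otimes V}$ of $Sp(W)$ on the space of such a $\pi$ with $$\omega(g)\pi(h)\omega(g)^{-1}=\pi(g(h))\qquad\text{for all } g\in Sp(W),\ h\in \mathrm{Heis}(W).$$ Such a pair $(\pi,\omega)$ exists, and for every such pair the restriction of $\omega$ to $G=SL_2(\mathbb F_q)=Sp(V)$, along $g\mapsto \mathrm{id}_U\otimes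 g$, has intertwining number $$(\omega_{U\otimes V},\omega_{U\otimes V})_G=\dim_{\mathbb C}\mathrm{End}_G(\omega_{U\otimes V})=2q+1.$$ The number of orbits of the diagonal action of $G$ on $V\times V$ is also $2q+1$. -/

import Mathlib

open scoped TensorProduct MatrixGroups

noncomputable section

/-- The Heisenberg group `W × F` attached to a vector space `W` with a bilinear form `B`. -/
@[ext]
structure Heisenberg {F W : Type*} [Field F] [AddCommGroup W] [Module F W]
    (B : LinearMap.BilinForm F W) where
  /-- The component in `W`. -/
  vec : W
  /-- The central component. -/
  ctr : F

namespace Heisenberg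

variable {F W : Type*} [Field F] [AddCommGroup W] [Module F W] {B : LinearMap.BilinForm F W}

/-- `(w, z) (w', z') = (w + w', z + z' + (1/2) ⟨w, w'⟩)`. -/
instance : Mul (Heisenberg B) :=
  ⟨fun h k => ⟨h.vec + k.vec, h.ctr + k.ctr + 2⁻¹ * B h.vec k.vec⟩⟩

instance : One (Heisenberg B) := ⟨⟨0, 0⟩⟩

/-- For an alternating form the correction term `B w w` vanishes and the inverse of `(w, z)` is
`(-w, -z)`. -/
instance : Inv (Heisenberg B) := ⟨fun h => ⟨-h.vec, -h.ctr + 2⁻¹ * B h.vec h.vec⟩⟩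

@[simp] theorem mul_vec (h k : Heisenberg B) : (h * k).vec = h.vec + k.vec := rfl

@[simp] theorem mul_ctr (h k : Heisenberg B) :
    (h * k).ctr = h.ctr + k.ctr + 2⁻¹ * B h.vec k.vec := rfl

@[simp] theorem one_vec : (1 : Heisenberg B).vec = 0 := rfl

@[simp] theorem one_ctr : (1 : Heisenberg B).ctr = 0 := rfl

@[simp] theorem inv_vec (h : Heisenberg B) : h⁻¹.vec = -h.vec := rfl

@[simp] theorem inv_ctr (h : Heisenberg B) : h⁻¹.ctr = -h.ctr + 2⁻¹ * B h.vec h.vec := rfl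

instance : Group (Heisenberg B) :=
  Group.ofLeftAxioms
    (fun a b c => by
      ext
      · simp [add_assoc]
      · simp only [mul_ctr, mul_vec, map_add, LinearMap.add_apply]; ring)
    (fun a => by ext <;> simp)
    (fun a => by ext <;> simp)

end Heisenberg

/-- The group `Sp(W)` of linear automorphisms of `W` that preserve the form `B`. -/
def Sp {F W : Type*} [Field F] [AddCommGroup W] [Module F W] (B : LinearMap.BilinForm F W) :
    Subgroup (W ≃ₗ[F] W) where
  carrier := {g | ∀ x y, B (g x) (g y) = B x y}
  mul_mem' := by
    intro a b ha hb x y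
    simp only [Set.mem_ofPred_eq] at ha hb
    simp [LinearEquiv.mul_apply, ha, hb]
  one_mem' := fun _ _ => rfl
  inv_mem' := by
    intro a ha x y
    have h := ha (a⁻¹ x) (a⁻¹ y)
    rw [← LinearEquiv.mul_apply, ← LinearEquiv.mul_apply, mul_inv_cancel] at h
    exact h.symm

/-- `Sp(W)` acts on the Heisenberg group by the automorphisms `g (w, z) = (g w, z)`. -/
def spAct {F W : Type*} [Field F] [AddCommGroup W] [Module F W] {B : LinearMap.BilinForm F W}
    (g : Sp B) : Heisenberg B →* Heisenberg B where
  toFun h := ⟨(g : W ≃ₗ[F] W) h.vec, h.ctr⟩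
  map_one' := by ext <;> simp
  map_mul' h k := by
    ext
    · simp
    · simp [g.2 h.vec k.vec]

/-- `π` is (a realization of) the Heisenberg representation with central character `ψ`:
it is irreducible, and the center acts through `ψ`. -/
structure IsHeisenbergRep {F W : Type*} [Field F] [AddCommGroup W] [Module F W]
    {B : LinearMap.BilinForm F W} (ψ : AddChar F ℂ) {H : Type*} [AddCommGroup H] [Module ℂ H]
    (π : Representation ℂ (Heisenberg B) H) : Prop where
  irreducible : π.IsIrreducible
  central : ∀ (z : F) (v : H), π ⟨0, z⟩ v = ψ z • v

/-- `ω` is an oscillator representation of `Sp(W)` on the space of the Heisenberg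
representation `π`: `ω(g) π(h) ω(g)⁻¹ = π(g(h))` for all `g` and `h`. -/
def IsOscillatorRep {F W : Type*} [Field F] [AddCommGroup W] [Module F W]
    {B : LinearMap.BilinForm F W} {H : Type*} [AddCommGroup H] [Module ℂ H]
    (π : Representation ℂ (Heisenberg B) H) (ω : Representation ℂ (Sp B) H) : Prop :=
  ∀ (g : Sp B) (h : Heisenberg B), ω g * π h * ω g⁻¹ = π (spAct g h)

/-- The intertwining number `dim Hom(ρ, σ)` of two representations of a group. -/
def intertwiningNumber {G H K : Type*} [Group G] [AddCommGroup H] [Module ℂ H]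
    [AddCommGroup K] [Module ℂ K] (ρ : Representation ℂ G H) (σ : Representation ℂ G K) : ℕ :=
  Module.finrank ℂ (Representation.IntertwiningMap ρ σ)

/-- The standard symplectic form `⟨v, v'⟩ = v₀ v'₁ - v₁ v'₀` on the plane `V = F²`. -/
def planeForm (F : Type*) [Field F] : LinearMap.BilinForm F (Fin 2 → F) :=
  Matrix.toBilin' !![0, 1; -1, 0]

theorem planeForm_apply {F : Type*} [Field F] (v w : Fin 2 → F) :
    planeForm F v w = v 0 * w 1 - v 1 * w 0 := by
  simp [planeForm, Matrix.toBilin'_apply', Matrix.mulVec, dotProduct, Fin.sum_univ_two]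
  ring

/-- The form `β ⊗ ⟨ , ⟩` on `U ⊗ V`. -/
def tensorForm {F U : Type*} [Field F] [AddCommGroup U] [Module F U]
    (β : LinearMap.BilinForm F U) : LinearMap.BilinForm F (U ⊗[F] (Fin 2 → F)) :=
  LinearMap.BilinForm.tmul β (planeForm F)

theorem tensorForm_tmul {F U : Type*} [Field F] [AddCommGroup U] [Module F U]
    (β : LinearMap.BilinForm F U) (u u' : U) (v v' : Fin 2 → F) :
    tensorForm β (u ⊗ₜ v) (u' ⊗ₜ v') = β u u' * planeForm F v v' := by
  simp [tensorForm, mul_comm]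

theorem planeForm_sl {F : Type*} [Field F] (g : SL(2, F)) (v w : Fin 2 → F) :
    planeForm F (Matrix.SpecialLinearGroup.toLin' g v) (Matrix.SpecialLinearGroup.toLin' g w) =
      planeForm F v w := by
  have h := g.2
  rw [Matrix.det_fin_two] at h
  simp only [planeForm_apply, Matrix.SpecialLinearGroup.toLin'_apply, Matrix.toLin'_apply,
    Matrix.mulVec, dotProduct, Fin.sum_univ_two]
  linear_combination (v 0 * w 1 - v 1 * w 0) * h

/-- The homomorphism `SL₂(F) → Sp(U ⊗ V)`, `g ↦ id ⊗ g`. -/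
def slToSp {F U : Type*} [Field F] [AddCommGroup U] [Module F U] (β : LinearMap.BilinForm F U) :
    SL(2, F) →* Sp (tensorForm β) where
  toFun g := ⟨(Matrix.SpecialLinearGroup.toLin' g).lTensor U, by
    intro x y
    induction x using TensorProduct.induction_on with
    | zero => simp
    | add a b ha hb => simp only [map_add, LinearMap.add_apply, ha, hb]
    | tmul u v =>
      induction y using TensorProduct.induction_on with
      | zero => simp
      | add a b ha hb => simp only [map_add, ha, hb]
      | tmul u' v' =>
        simp only [LinearEquiv.lTensor_tmul, tensorForm_tmul, planeForm_sl]⟩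
  map_one' := by
    apply Subtype.ext
    apply LinearEquiv.toLinearMap_injective
    apply TensorProduct.ext'
    intro u v
    simp
  map_mul' g k := by
    apply Subtype.ext
    apply LinearEquiv.toLinearMap_injective
    apply TensorProduct.ext'
    intro u v
    simp

/-- The orbit of `(u, v)` under the diagonal action of `SL₂(F)` on `V × V`. -/
def diagOrbit {F : Type*} [Field F] (p : (Fin 2 → F) × (Fin 2 → F)) :
    Set ((Fin 2 → F) × (Fin 2 → F)) :=
  Set.range fun g : SL(2, F) =>
    (Matrix.SpecialLinearGroup.toLin' g p.1, Matrix.SpecialLinearGroup.toLin' g p.2)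

end

/-! The Weyl operators `π ⟨w, 0⟩` form a basis of `End H`, and conjugation by `ω g` permutes them by
`w ↦ g w`. So `End H` is the permutation representation of `G` on functions on `W`, and its
`G`-invariants have the number of `G`-orbits on `W` as dimension (`intertwiningNumber_eq_card`). A
basis of `U` identifies `W` with `V × V` as a `G`-set. There the orbits are those of independent
pairs, classified by their determinant (`q - 1`), of `(0, 0)`, of `(0, e₀)`, and of `(e₀, a e₀)`
(`q`): `2q + 1` in all.

Existence uses the Schrödinger model on functions on `U`. Each symplectic `g` permutes the Weyl
basis by an algebra automorphism of `End H`, which is inner, so `g` is implemented by an operator,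
unique up to a scalar by Schur. Parity commutes with these operators and has trace one, so its
eigenspaces differ in dimension by one; the ratio of the determinants on them removes the scalar
ambiguity (`exists_representation_of_projective`). -/

noncomputable section

namespace IsHeisenbergRep

/-! ### Relations among Weyl operators -/

section Weyl

variable {F W : Type*} [Field F] [AddCommGroup W] [Module F W]
  {B : LinearMap.BilinForm F W} {ψ : AddChar F ℂ} {H : Type*} [AddCommGroup H] [Module ℂ H]
  {π : Representation ℂ (Heisenberg B) H}

theorem apply_eq_smul (hπ : IsHeisenbergRep ψ π) (h : Heisenberg B) :
    π h = ψ h.ctr • π ⟨h.vec, 0⟩ := by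
  have : h = ⟨0, h.ctr⟩ * ⟨h.vec, 0⟩ := by ext <;> simp
  conv_lhs => rw [this, map_mul]
  ext v
  simp [hπ.central]

theorem weyl_mul (hπ : IsHeisenbergRep ψ π) (w x : W) :
    π ⟨w, 0⟩ * π ⟨x, 0⟩ = ψ (2⁻¹ * B w x) • π ⟨w + x, 0⟩ := by
  rw [← map_mul, hπ.apply_eq_smul]
  simp

theorem weyl_zero : π ⟨0, 0⟩ = 1 := map_one π

theorem weyl_mul_neg (halt : B.IsAlt) (hπ : IsHeisenbergRep ψ π) (w : W) :
    π ⟨w, 0⟩ * π ⟨-w, 0⟩ = 1 := by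
  rw [hπ.weyl_mul]
  simp [halt.self_eq_zero, weyl_zero]

theorem weyl_neg_mul (halt : B.IsAlt) (hπ : IsHeisenbergRep ψ π) (w : W) :
    π ⟨-w, 0⟩ * π ⟨w, 0⟩ = 1 := by
  simpa using hπ.weyl_mul_neg halt (-w)

/-- As `B` is alternating, the two cocycle terms `B w x / 2` and `B (w + x) (-w) / 2` are equal. -/
theorem weyl_conj (h2 : (2 : F) ≠ 0) (halt : B.IsAlt) (hπ : IsHeisenbergRep ψ π) (w x : W) :
    π ⟨w, 0⟩ * π ⟨x, 0⟩ * π ⟨-w, 0⟩ = ψ (B w x) • π ⟨x, 0⟩ := by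
  rw [hπ.weyl_mul, smul_mul_assoc, hπ.weyl_mul, smul_smul, ← AddChar.map_add_eq_mul]
  congr 2
  · have := halt.neg_eq w x
    simp only [map_add, map_neg, LinearMap.add_apply, halt.self_eq_zero]
    rw [← this]
    field_simp
    ring
  · simp

theorem weyl_comm (h2 : (2 : F) ≠ 0) (halt : B.IsAlt) (hπ : IsHeisenbergRep ψ π) (w x : W) :
    π ⟨w, 0⟩ * π ⟨x, 0⟩ = ψ (B w x) • (π ⟨x, 0⟩ * π ⟨w, 0⟩) := by
  rw [← smul_mul_assoc, ← hπ.weyl_conj h2 halt, mul_assoc, hπ.weyl_neg_mul halt, mul_one]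

theorem nontrivial (hπ : IsHeisenbergRep ψ π) : Nontrivial H := by
  have := hπ.irreducible
  by_contra h
  rw [not_nontrivial_iff_subsingleton] at h
  apply bot_ne_top (α := Subrepresentation π)
  ext v
  simp [Subsingleton.elim v 0]

end Weyl

/-! ### Weyl operators as a basis of the endomorphism algebra -/

section Finite

variable {F W : Type*} [Field F] [AddCommGroup W] [Module F W] [Fintype W]
  {B : LinearMap.BilinForm F W} {ψ : AddChar F ℂ} {H : Type*} [AddCommGroup H] [Module ℂ H]
  {π : Representation ℂ (Heisenberg B) H}

theorem _root_.AddChar.sum_bilinForm_eq_zero (hψ : ψ ≠ 1) (hB : B.SeparatingRight)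
    {x : W} (hx : x ≠ 0) : ∑ w, ψ (B w x) = 0 := by
  let χ : AddChar W ℂ := ψ.compAddMonoidHom (B.flip x).toAddMonoidHom
  change ∑ w, χ w = 0
  rw [AddChar.sum_eq_zero_iff_ne_zero]
  intro h0
  obtain ⟨a, ha⟩ := AddChar.ne_one_iff.1 hψ
  obtain ⟨w, hw⟩ : ∃ w, B w x ≠ 0 := by
    by_contra! h
    exact hx (hB x h)
  apply ha
  have := DFunLike.congr_fun h0 ((a / B w x) • w)
  simpa [χ, hw] using this

/-- The finitely many Weyl translates of one nonzero vector span a subrepresentation. Finite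
dimension is what makes Schur's lemma available. -/
theorem finiteDimensional (hπ : IsHeisenbergRep ψ π) : FiniteDimensional ℂ H := by
  have := hπ.irreducible
  obtain ⟨v, hv⟩ : ∃ v : H, v ≠ 0 := by
    by_contra! h
    apply bot_ne_top (α := Subrepresentation π)
    ext v
    simp [h v]
  let S : Subrepresentation π :=
    { toSubmodule := Submodule.span ℂ (Set.range fun w : W => π ⟨w, 0⟩ v)
      apply_mem_toSubmodule := by
        intro h x hx
        induction hx using Submodule.span_induction with
        | mem x hx =>
          obtain ⟨w, rfl⟩ := hx
          rw [hπ.apply_eq_smul, LinearMap.smul_apply, ← Module.End.mul_apply, hπ.weyl_mul]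
          exact Submodule.smul_mem _ _ (Submodule.smul_mem _ _ (Submodule.subset_span ⟨_, rfl⟩))
        | zero => simp
        | add x y _ _ hx hy => rw [map_add]; exact add_mem hx hy
        | smul a x _ hx => rw [map_smul]; exact Submodule.smul_mem _ _ hx }
  have hS : S = ⊤ := by
    refine (eq_bot_or_eq_top S).resolve_left fun h => hv ?_
    have hvS : v ∈ S.toSubmodule := Submodule.subset_span ⟨0, by simp [weyl_zero]⟩
    rw [h] at hvS
    exact hvS
  have hS' : Submodule.span ℂ (Set.range fun w : W => π ⟨w, 0⟩ v) = ⊤ :=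
    congrArg Subrepresentation.toSubmodule hS
  exact ⟨⟨(Set.finite_range fun w : W => π ⟨w, 0⟩ v).toFinset, by simpa using hS'⟩⟩

theorem exists_eq_smul_one (hπ : IsHeisenbergRep ψ π) (T : Module.End ℂ H)
    (hT : ∀ w, T * π ⟨w, 0⟩ = π ⟨w, 0⟩ * T) : ∃ c : ℂ, T = c • 1 := by
  have := hπ.irreducible
  have := hπ.finiteDimensional
  let f : π.IntertwiningMap π := ⟨T, fun h => by
    change T * π h = π h * T
    rw [hπ.apply_eq_smul, mul_smul_comm, hT, smul_mul_assoc]⟩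
  obtain ⟨c, hc⟩ := (Representation.IsIrreducible.algebraMap_intertwiningMap_bijective_of_isAlgClosed
    (V := H) (ρ := π)).2 f
  refine ⟨c, ?_⟩
  ext v
  have := DFunLike.congr_fun hc v
  simpa [f, Algebra.algebraMap_eq_smul_one] using this.symm

variable (h2 : (2 : F) ≠ 0) (hψ : ψ ≠ 1) (halt : B.IsAlt) (hB : B.SeparatingRight)
include h2 hψ halt hB

/-- Weyl operators are eigenvectors of conjugation for distinct characters `y ↦ ψ (B y w)`;
averaging a relation against the character of `x` isolates the coefficient at `x`. -/
theorem linearIndependent_weyl (hπ : IsHeisenbergRep ψ π) :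
    LinearIndependent ℂ fun w : W => π ⟨w, 0⟩ := by
  classical
  rw [Fintype.linearIndependent_iff]
  intro c hc x
  have key : ∑ y, ∑ w, c w • (ψ (B y (w - x)) • π ⟨w, 0⟩) = 0 := by
    refine Finset.sum_eq_zero fun y _ => ?_
    have h0 : π ⟨y, 0⟩ * (∑ w, c w • π ⟨w, 0⟩) * π ⟨-y, 0⟩ = 0 := by rw [hc]; simp
    rw [Finset.mul_sum, Finset.sum_mul] at h0
    simp only [mul_smul_comm, smul_mul_assoc, hπ.weyl_conj h2 halt] at h0
    rw [← smul_zero (M := ℂ) (A := Module.End ℂ H) (ψ (-(B y x))), ← h0, Finset.smul_sum]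
    refine Finset.sum_congr rfl fun w _ => ?_
    rw [map_sub, sub_eq_add_neg, AddChar.map_add_eq_mul, smul_smul, smul_smul, smul_smul]
    congr 1; ring
  rw [Finset.sum_comm, Finset.sum_eq_single x] at key
  · simp only [sub_self, map_zero, AddChar.map_zero_eq_one, one_smul, Finset.sum_const,
      ← Nat.cast_smul_eq_nsmul ℂ] at key
    rw [smul_eq_zero, smul_eq_zero] at key
    rcases key with h | h | h
    · simp at h
    · exact h
    · have := hπ.nontrivial
      have h1 : π ⟨x, 0⟩ * π ⟨-x, 0⟩ = 0 := by rw [h, zero_mul]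
      rw [hπ.weyl_mul_neg halt] at h1
      exact absurd h1 one_ne_zero
  · intro w _ hw
    rw [← Finset.smul_sum, ← Finset.sum_smul, AddChar.sum_bilinForm_eq_zero hψ hB (sub_ne_zero.2 hw)]
    simp
  · simp

/-- Fourier analysis of conjugation: `A x` is the component of `T` with the same character as `π ⟨x,
0⟩`, so by Schur it is a multiple of that operator, and Fourier inversion recovers `T`. -/
theorem span_weyl (hπ : IsHeisenbergRep ψ π) :
    Submodule.span ℂ (Set.range fun w : W => π ⟨w, 0⟩) = ⊤ := by
  classical
  rw [eq_top_iff]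
  intro T _
  let A : W → Module.End ℂ H := fun x => ∑ y, ψ (B x y) • (π ⟨y, 0⟩ * T * π ⟨-y, 0⟩)
  have hA (x w : W) : π ⟨w, 0⟩ * A x * π ⟨-w, 0⟩ = ψ (B w x) • A x := by
    simp only [A, Finset.mul_sum, Finset.sum_mul, Finset.smul_sum]
    refine Fintype.sum_equiv (Equiv.addLeft w) _ _ fun y => ?_
    simp only [Equiv.coe_addLeft, mul_smul_comm, smul_mul_assoc]
    have h1 : π ⟨w, 0⟩ * (π ⟨y, 0⟩ * T * π ⟨-y, 0⟩) * π ⟨-w, 0⟩ =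
        π ⟨w + y, 0⟩ * T * π ⟨-(w + y), 0⟩ := by
      have h2 : π ⟨w, 0⟩ * (π ⟨y, 0⟩ * T * π ⟨-y, 0⟩) * π ⟨-w, 0⟩ =
        (π ⟨w, 0⟩ * π ⟨y, 0⟩) * T * (π ⟨-y, 0⟩ * π ⟨-w, 0⟩) := by simp only [mul_assoc]
      rw [h2, hπ.weyl_mul, hπ.weyl_mul, smul_mul_assoc, smul_mul_smul_comm,
        ← AddChar.map_add_eq_mul]
      have : 2⁻¹ * B w y + 2⁻¹ * B (-y) (-w) = 0 := by
        rw [← halt.neg_eq y w]; simp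
      rw [this]
      simp [add_comm]
    rw [h1, smul_smul, ← AddChar.map_add_eq_mul]
    congr 2
    rw [map_add, ← halt.neg_eq x w]
    ring
  have hmem (x : W) : A x ∈ Submodule.span ℂ (Set.range fun w : W => π ⟨w, 0⟩) := by
    obtain ⟨c, hc⟩ := hπ.exists_eq_smul_one (π ⟨-x, 0⟩ * A x) fun w => by
      have h1 : A x * π ⟨w, 0⟩ = ψ (B x w) • (π ⟨w, 0⟩ * A x) := by
        have := congrArg (· * π ⟨w, 0⟩) (hA x w)
        simp only [mul_assoc, hπ.weyl_neg_mul halt, mul_one] at this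
        rw [this, smul_mul_assoc, smul_smul, ← AddChar.map_add_eq_mul, ← halt.neg_eq x w]
        simp
      rw [mul_assoc, h1, ← mul_assoc (π ⟨w, 0⟩), hπ.weyl_comm h2 halt w (-x), mul_smul_comm,
        smul_mul_assoc, mul_assoc, ← halt.neg_eq w x, map_neg (B w)]
    have : A x = c • π ⟨x, 0⟩ := by
      have := congrArg (π ⟨x, 0⟩ * ·) hc
      simpa only [← mul_assoc, hπ.weyl_mul_neg halt, one_mul, mul_smul_comm, mul_one] using this
    rw [this]
    exact Submodule.smul_mem _ _ (Submodule.subset_span ⟨x, rfl⟩)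
  have hsum : ∑ x, A x = (Fintype.card W : ℂ) • T := by
    simp only [A]
    rw [Finset.sum_comm, Finset.sum_eq_single 0]
    · simp [weyl_zero, Finset.sum_const, ← Nat.cast_smul_eq_nsmul ℂ]
    · intro y _ hy
      rw [← Finset.sum_smul, AddChar.sum_bilinForm_eq_zero hψ hB hy, zero_smul]
    · simp
  have hcard : (Fintype.card W : ℂ) ≠ 0 := by simp
  have : T = (Fintype.card W : ℂ)⁻¹ • ∑ x, A x := by
    rw [hsum, smul_smul, inv_mul_cancel₀ hcard, one_smul]
  rw [this]
  exact Submodule.smul_mem _ _ (Submodule.sum_mem _ fun x _ => hmem x)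

/-- The Weyl operators `π (w, 0)` form a basis of the endomorphism algebra. -/
def weylBasis (hπ : IsHeisenbergRep ψ π) : Module.Basis W ℂ (Module.End ℂ H) :=
  .mk (hπ.linearIndependent_weyl h2 hψ halt hB) (hπ.span_weyl h2 hψ halt hB).ge

@[simp] theorem weylBasis_apply (hπ : IsHeisenbergRep ψ π) (w : W) :
    hπ.weylBasis h2 hψ halt hB w = π ⟨w, 0⟩ := by
  simp [weylBasis]

/-- Any symplectic transformation is implemented by an operator on the Heisenberg
representation. -/
theorem exists_implementer (hπ : IsHeisenbergRep ψ π) (g : Sp B) :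
    ∃ M : (Module.End ℂ H)ˣ, ∀ w, (M : Module.End ℂ H) * π ⟨w, 0⟩ =
      π ⟨(g : W ≃ₗ[F] W) w, 0⟩ * M := by
  let b := hπ.weylBasis h2 hψ halt hB
  let L : Module.End ℂ H ≃ₗ[ℂ] Module.End ℂ H := b.equiv b (g : W ≃ₗ[F] W).toEquiv
  have hL (w : W) : L (π ⟨w, 0⟩) = π ⟨(g : W ≃ₗ[F] W) w, 0⟩ := by
    have := b.equiv_apply w b (g : W ≃ₗ[F] W).toEquiv
    simpa [b] using this
  have hone : L 1 = 1 := by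
    rw [← weyl_zero (π := π), hL]; simp
  -- Checked on basis pairs, where it says that `g` preserves the cocycle `ψ (B w w' / 2)`.
  have hmul (x y) : L (x * y) = L x * L y := by
    have : (LinearMap.mul ℂ (Module.End ℂ H)).compr₂ L.toLinearMap =
        (LinearMap.mul ℂ (Module.End ℂ H)).compl₁₂ L.toLinearMap L.toLinearMap := by
      refine b.ext fun w => b.ext fun w' => ?_
      simp only [b, weylBasis_apply, LinearMap.compr₂_apply, LinearMap.mul_apply',
        LinearMap.compl₁₂_apply, LinearEquiv.coe_coe, hL, hπ.weyl_mul, map_smul, map_add, g.2 w w']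
    exact LinearMap.congr_fun₂ this x y
  -- Skolem–Noether: every algebra automorphism of `End H` is a conjugation.
  obtain ⟨T, hT⟩ := LinearEquiv.conjAlgEquiv_surjective ℂ H H (AlgEquiv.ofLinearEquiv L hone hmul)
  refine ⟨LinearMap.GeneralLinearGroup.ofLinearEquiv T, fun w => ?_⟩
  have := DFunLike.congr_fun hT (π ⟨w, 0⟩)
  rw [AlgEquiv.ofLinearEquiv_apply, hL] at this
  rw [← this]
  ext v
  simp [LinearMap.GeneralLinearGroup.ofLinearEquiv]

end Finite

end IsHeisenbergRep

/-! ### Intertwining numbers as orbit counts -/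

namespace IsHeisenbergRep

theorem _root_.IsOscillatorRep.mul_weyl {F W : Type*} [Field F] [AddCommGroup W] [Module F W]
    {B : LinearMap.BilinForm F W} {H : Type*} [AddCommGroup H] [Module ℂ H]
    {π : Representation ℂ (Heisenberg B) H} {ω : Representation ℂ (Sp B) H}
    (hω : IsOscillatorRep π ω) (g : Sp B) (w : W) :
    ω g * π ⟨w, 0⟩ = π ⟨(g : W ≃ₗ[F] W) w, 0⟩ * ω g := by
  have h : ω g⁻¹ * ω g = 1 := by rw [← map_mul, inv_mul_cancel, map_one]
  have := hω g ⟨w, 0⟩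
  change _ = π ⟨(g : W ≃ₗ[F] W) w, 0⟩ at this
  rw [← this, mul_assoc _ _ (ω g), h, mul_one]

variable {F W : Type*} [Field F] [AddCommGroup W] [Module F W] [Fintype W]
  {B : LinearMap.BilinForm F W} {ψ : AddChar F ℂ} {H : Type*} [AddCommGroup H] [Module ℂ H]
  {π : Representation ℂ (Heisenberg B) H}
  (h2 : (2 : F) ≠ 0) (hψ : ψ ≠ 1) (halt : B.IsAlt) (hB : B.SeparatingRight)
include h2 hψ halt hB

/-- The intertwining number of the restriction of the oscillator representation to a group `G` of
symplectic transformations is the number of `G`-orbits on the symplectic space; the orbits are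
presented here as the fibres of a surjective map `f`. -/
theorem intertwiningNumber_eq_card (hπ : IsHeisenbergRep ψ π) {ω : Representation ℂ (Sp B) H}
    (hω : IsOscillatorRep π ω) {G : Type*} [Group G] (ρ : G →* Sp B) {Q : Type*} [Finite Q]
    (f : W → Q) (hsurj : Function.Surjective f)
    (hf : ∀ x y, f x = f y ↔ ∃ g, (ρ g : W ≃ₗ[F] W) x = y) :
    intertwiningNumber (ω.comp ρ) (ω.comp ρ) = Nat.card Q := by
  have := Fintype.ofFinite Q
  let b := hπ.weylBasis h2 hψ halt hB
  have hconj (g : G) (a : W → ℂ) : ω (ρ g) * ∑ w, a w • b w =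
      (∑ w, a ((ρ g)⁻¹.1 w) • b w) * ω (ρ g) := by
    rw [Finset.mul_sum, Finset.sum_mul]
    refine Fintype.sum_equiv (ρ g : W ≃ₗ[F] W).toEquiv _ _ fun w => ?_
    simp [b, hω.mul_weyl]
  have hunit (g : Sp B) : ω g * ω g⁻¹ = 1 := by rw [← map_mul, mul_inv_cancel, map_one]
  -- Functions constant on orbits, read as coefficients in the Weyl basis, give exactly the
  -- intertwiners.
  let Φ : (Q → ℂ) →ₗ[ℂ] Representation.IntertwiningMap (ω.comp ρ) (ω.comp ρ) :=
    { toFun c := ⟨∑ w, c (f w) • b w, fun g => by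
        change (∑ w, c (f w) • b w) * ω (ρ g) = ω (ρ g) * ∑ w, c (f w) • b w
        rw [hconj g fun w => c (f w)]
        congr 1
        refine Finset.sum_congr rfl fun w _ => ?_
        have : f w = f ((ρ g)⁻¹.1 w) := (hf _ _).2 ⟨g⁻¹, by rw [map_inv]⟩
        rw [this]⟩
      map_add' c d := by
        ext1
        simp [add_smul, Finset.sum_add_distrib]
      map_smul' a c := by
        ext1
        simp [mul_smul, Finset.smul_sum] }
  have hΦ : Function.Bijective Φ := by
    constructor
    · rw [injective_iff_map_eq_zero]
      intro c hc
      have h0 : ∑ w, c (f w) • b w = 0 := congrArg Representation.IntertwiningMap.toLinearMap hc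
      funext q
      obtain ⟨w, rfl⟩ := hsurj q
      exact Fintype.linearIndependent_iff.1 b.linearIndependent _ h0 w
    · intro T
      let a : W → ℂ := b.equivFun T.toLinearMap
      have hT : ∑ w, a w • b w = T.toLinearMap := b.sum_equivFun T.toLinearMap
      have ha (g : G) (w : W) : a ((ρ g)⁻¹.1 w) = a w := by
        have h1 : T.toLinearMap * ω (ρ g) = ω (ρ g) * T.toLinearMap := T.isIntertwining' g
        rw [← hT, hconj g a] at h1
        have h2 := congrArg (· * ω (ρ g)⁻¹) h1
        simp only [mul_assoc, hunit, mul_one] at h2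
        have h3 := congrArg (fun S => b.equivFun S w) h2
        simp only [b.equivFun_apply, b.repr_sum_self] at h3
        exact h3.symm
      refine ⟨fun q => a (Function.surjInv hsurj q), ?_⟩
      ext1
      change ∑ w, a (Function.surjInv hsurj (f w)) • b w = _
      rw [← hT]
      refine Finset.sum_congr rfl fun w _ => ?_
      obtain ⟨g, hg⟩ := (hf w (Function.surjInv hsurj (f w))).1 (Function.surjInv_eq hsurj _).symm
      rw [← ha g⁻¹ w, map_inv, inv_inv, hg]
  rw [intertwiningNumber, ← (LinearEquiv.ofBijective Φ hΦ).finrank_eq, Module.finrank_pi,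
    Nat.card_eq_fintype_card]

end IsHeisenbergRep

/-! ### Orbits of `SL₂` on pairs of vectors -/

section Orbits

variable {F : Type*} [Field F]

theorem toLin'_eq_vec (g : SL(2, F)) (v : Fin 2 → F) :
    Matrix.SpecialLinearGroup.toLin' g v =
      ![g.1 0 0 * v 0 + g.1 0 1 * v 1, g.1 1 0 * v 0 + g.1 1 1 * v 1] := by
  ext i
  fin_cases i <;>
    simp only [Matrix.SpecialLinearGroup.toLin'_apply, Matrix.toLin'_apply, Matrix.mulVec,
      dotProduct, Fin.sum_univ_two] <;> rfl

theorem mem_diagOrbit_iff {p r : (Fin 2 → F) × (Fin 2 → F)} :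
    r ∈ diagOrbit p ↔ ∃ g : SL(2, F), Matrix.SpecialLinearGroup.toLin' g p.1 = r.1 ∧
      Matrix.SpecialLinearGroup.toLin' g p.2 = r.2 := by
  simp [diagOrbit, Prod.ext_iff]

theorem diagOrbit_eq_iff {p r : (Fin 2 → F) × (Fin 2 → F)} :
    diagOrbit p = diagOrbit r ↔ ∃ g : SL(2, F), Matrix.SpecialLinearGroup.toLin' g p.1 = r.1 ∧
      Matrix.SpecialLinearGroup.toLin' g p.2 = r.2 := by
  rw [← mem_diagOrbit_iff]
  constructor
  · intro h
    rw [h]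
    exact ⟨1, by simp⟩
  · rintro ⟨g, rfl⟩
    ext s
    constructor
    · rintro ⟨k, rfl⟩
      exact ⟨k * g⁻¹, by simp⟩
    · rintro ⟨k, rfl⟩
      exact ⟨k * g, by simp⟩

/-- A pair of vectors of the plane in standard position: independent vectors `e₀`, `d e₁`, the zero
pair, `(0, e₀)`, or `(e₀, a e₀)`. -/
def standardPair : Fˣ ⊕ Option (Option F) → (Fin 2 → F) × (Fin 2 → F)
  | .inl d => (![1, 0], ![0, d])
  | .inr none => (0, 0)
  | .inr (some none) => (0, ![1, 0])
  | .inr (some (some a)) => (![1, 0], ![a, 0])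

theorem exists_toLin'_eq {u v : Fin 2 → F} (h : u 0 * v 1 - v 0 * u 1 = 1) :
    ∃ g : SL(2, F), ∀ a b, Matrix.SpecialLinearGroup.toLin' g ![a, b] = a • u + b • v := by
  obtain ⟨g, hg⟩ : ∃ g : SL(2, F), g.1 = !![u 0, v 0; u 1, v 1] :=
    ⟨⟨_, by rw [Matrix.det_fin_two_of, h]⟩, rfl⟩
  refine ⟨g, fun a b => ?_⟩
  rw [toLin'_eq_vec, hg]
  ext i
  fin_cases i <;> simp [mul_comm]

theorem exists_toLin'_e₀ {u : Fin 2 → F} (hu : u ≠ 0) :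
    ∃ g : SL(2, F), Matrix.SpecialLinearGroup.toLin' g ![1, 0] = u := by
  by_cases h : u 0 = 0
  · have h1 : u 1 ≠ 0 := fun h1 => hu (by ext i; fin_cases i <;> simp [h, h1])
    obtain ⟨g, hg⟩ := exists_toLin'_eq (u := u) (v := ![-(u 1)⁻¹, 0]) (by simp [h1])
    exact ⟨g, by simp [hg]⟩
  · obtain ⟨g, hg⟩ := exists_toLin'_eq (u := u) (v := ![0, (u 0)⁻¹]) (by simp [h])
    exact ⟨g, by simp [hg]⟩

theorem exists_diagOrbit_standardPair (p : (Fin 2 → F) × (Fin 2 → F)) :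
    ∃ r, diagOrbit (standardPair r) = diagOrbit p := by
  obtain ⟨u, v⟩ := p
  simp only [diagOrbit_eq_iff]
  by_cases hd : planeForm F u v = 0
  · by_cases hu : u = 0
    · by_cases hv : v = 0
      · exact ⟨.inr none, 1, by simp [standardPair, hu, hv]⟩
      · obtain ⟨g, hg⟩ := exists_toLin'_e₀ hv
        exact ⟨.inr (some none), g, by simp [standardPair, hu, hg]⟩
    · obtain ⟨g, hg⟩ := exists_toLin'_e₀ hu
      obtain ⟨a, ha⟩ : ∃ a : F, a • u = v := by
        rw [planeForm_apply] at hd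
        by_cases h : u 0 = 0
        · have h1 : u 1 ≠ 0 := fun h1 => hu (by ext i; fin_cases i <;> simp [h, h1])
          have h0 : v 0 = 0 := by simpa [h, h1] using hd
          exact ⟨v 1 / u 1, by ext i; fin_cases i <;> simp [h, h1, h0]⟩
        · refine ⟨v 0 / u 0, ?_⟩
          ext i
          fin_cases i
          · simp [h]
          · simp only [Fin.mk_one, Pi.smul_apply, smul_eq_mul]
            field_simp
            linear_combination -hd
      refine ⟨.inr (some (some a)), g, hg, ?_⟩
      have : standardPair (.inr (some (some a))) = (![1, 0], a • ![1, 0]) := by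
        simp [standardPair]
      rw [this, map_smul, hg, ha]
  -- Dividing `v` by `d = ⟨u, v⟩` gives columns of determinant one, so `g` carries `(e₀, d e₁)` to
  -- `(u, v)`.
  · obtain ⟨g, hg⟩ := exists_toLin'_eq (u := u) (v := (planeForm F u v)⁻¹ • v) (by
      rw [← inv_mul_cancel₀ hd, Pi.smul_apply, Pi.smul_apply, smul_eq_mul, smul_eq_mul]
      nth_rw 4 [planeForm_apply]
      ring)
    refine ⟨.inl (Units.mk0 _ hd), g, ?_, ?_⟩
    · simp [standardPair, hg]
    · simp [standardPair, hg, smul_smul, hd]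

/-- The form separates the independent pairs. Among dependent ones, vanishing of the entries is
invariant, and an element fixing `e₀` fixes `a e₀`. -/
theorem diagOrbit_standardPair_injective :
    Function.Injective fun r : Fˣ ⊕ Option (Option F) => diagOrbit (standardPair r) := by
  intro r s h
  obtain ⟨g, h1, h2⟩ := diagOrbit_eq_iff.1 h
  have hd := planeForm_sl g (standardPair r).1 (standardPair r).2
  rw [h1, h2] at hd
  have e0 : (![1, 0] : Fin 2 → F) ≠ 0 := fun h => by simpa using congrFun h 0
  rcases r with d | _ | _ | a <;> rcases s with d' | _ | _ | a' <;>
    simp [standardPair, planeForm_apply, e0, e0.symm] at hd h1 h2 ⊢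
  · exact Units.ext hd.symm
  · exact d.ne_zero hd.symm
  · have ha : (![a, 0] : Fin 2 → F) = a • ![1, 0] := by simp
    rw [ha, map_smul, h1] at h2
    simpa using congrFun h2 0

theorem ncard_range_diagOrbit [Finite F] :
    (Set.range (diagOrbit (F := F))).ncard = 2 * Nat.card F + 1 := by
  have : Set.range (diagOrbit (F := F)) =
      Set.range fun r : Fˣ ⊕ Option (Option F) => diagOrbit (standardPair r) := by
    ext s
    constructor
    · rintro ⟨p, rfl⟩
      exact exists_diagOrbit_standardPair p
    · rintro ⟨r, rfl⟩
      exact ⟨_, rfl⟩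
  rw [this, ← Nat.card_coe_set_eq, Nat.card_range_of_injective diagOrbit_standardPair_injective,
    Nat.card_sum, Finite.card_option, Finite.card_option, Nat.card_units]
  -- The count is `(q - 1) + (q + 2)` with truncated subtraction, hence the need for `q > 0`.
  have := Nat.card_pos (α := F)
  omega

end Orbits

/-! ### Coordinates on `U ⊗ V` -/

section Coordinates

variable {F U : Type*} [Field F] [AddCommGroup U] [Module F U]

theorem exists_equiv_prod_plane (hU : Module.finrank F U = 2) (β : LinearMap.BilinForm F U) :
    ∃ e : U ⊗[F] (Fin 2 → F) ≃ (Fin 2 → F) × (Fin 2 → F), ∀ (g : SL(2, F)) x,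
      e ((slToSp β g : (U ⊗[F] (Fin 2 → F)) ≃ₗ[F] _) x) =
        (Matrix.SpecialLinearGroup.toLin' g (e x).1, Matrix.SpecialLinearGroup.toLin' g (e x).2) := by
  have : FiniteDimensional F U := Module.finite_of_finrank_eq_succ hU
  let b : Module.Basis (Fin 2) F U := Module.finBasisOfFinrankEq F U hU
  let e : U ⊗[F] (Fin 2 → F) ≃ₗ[F] Fin 2 → (Fin 2 → F) :=
    TensorProduct.congr b.equivFun (LinearEquiv.refl F _) ≪≫ₗ TensorProduct.comm F _ _ ≪≫ₗ
      TensorProduct.piScalarRight F F (Fin 2 → F) (Fin 2)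
  have he (g : SL(2, F)) (x) (i : Fin 2) : e ((slToSp β g : (U ⊗[F] (Fin 2 → F)) ≃ₗ[F] _) x) i =
      Matrix.SpecialLinearGroup.toLin' g (e x i) := by
    induction x using TensorProduct.induction_on with
    | zero => simp
    | add x y hx hy => simp only [map_add, Pi.add_apply, hx, hy]
    | tmul u v => simp [e, slToSp]
  refine ⟨e.toEquiv.trans (finTwoArrowEquiv _), fun g x => ?_⟩
  ext1
  · exact he g x 0
  · exact he g x 1

/-- Splits `U ⊗ V` into two isotropic copies of `U` paired by `β`, the polarization behind the
Schrödinger model. -/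
theorem tensorForm_apply (β : LinearMap.BilinForm F U) (x y : U ⊗[F] (Fin 2 → F)) :
    tensorForm β x y =
      β (TensorProduct.piScalarRight F F U (Fin 2) x 0)
        (TensorProduct.piScalarRight F F U (Fin 2) y 1) -
      β (TensorProduct.piScalarRight F F U (Fin 2) x 1)
        (TensorProduct.piScalarRight F F U (Fin 2) y 0) := by
  induction x using TensorProduct.induction_on with
  | zero => simp
  | add a b ha hb => simp only [map_add, LinearMap.add_apply, Pi.add_apply, ha, hb]; ring
  | tmul u v =>
    induction y using TensorProduct.induction_on with
    | zero => simp
    | add a b ha hb => simp only [map_add, Pi.add_apply, ha, hb]; ring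
    | tmul u' v' =>
      simp [tensorForm_tmul, planeForm_apply]
      ring

theorem tensorForm_isAlt {β : LinearMap.BilinForm F U} (hβ : β.IsSymm) : (tensorForm β).IsAlt := by
  intro x
  rw [tensorForm_apply, hβ.eq]
  simp

theorem tensorForm_separatingRight {β : LinearMap.BilinForm F U} (hβ : β.SeparatingRight) :
    (tensorForm β).SeparatingRight := by
  intro y hy
  let e := TensorProduct.piScalarRight F F U (Fin 2)
  rw [← e.map_eq_zero_iff]
  ext i
  apply hβ
  intro u
  fin_cases i
  · simpa [tensorForm_apply, e] using hy (e.symm (Pi.single 1 u))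
  · simpa [tensorForm_apply, e] using hy (e.symm (Pi.single 0 u))

end Coordinates

/-! ### From projective to linear representations -/

section Linearization

variable {H : Type*} [AddCommGroup H] [Module ℂ H]

/-- The part of `H` on which `P` acts as the scalar `ε`. -/
abbrev scalarPart (P : Module.End ℂ H) (ε : ℂ) : Submodule ℂ H := LinearMap.ker (P - ε • 1)

theorem mem_scalarPart {P : Module.End ℂ H} {ε : ℂ} {v : H} :
    v ∈ scalarPart P ε ↔ P v = ε • v := by
  simp [scalarPart, sub_eq_zero]

theorem map_mem_scalarPart {P M : Module.End ℂ H} (ε : ℂ) (hM : M ∈ Submonoid.centralizer {P})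
    (v : H) (hv : v ∈ scalarPart P ε) : M v ∈ scalarPart P ε := by
  rw [mem_scalarPart] at hv ⊢
  have : P * M = M * P := Submonoid.mem_centralizer_iff.1 hM P rfl
  rw [← Module.End.mul_apply, this, Module.End.mul_apply, hv, map_smul]

/-- The determinant on the `ε`-part of `P`, for operators commuting with `P`. -/
def partDet (P : Module.End ℂ H) (ε : ℂ) : Submonoid.centralizer {P} →* ℂ where
  toFun M := LinearMap.det (M.1.restrict (map_mem_scalarPart ε M.2))
  map_one' := by
    convert LinearMap.det_id
    rfl
  map_mul' M N := by
    rw [← map_mul]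
    congr 1

theorem partDet_smul (P : Module.End ℂ H) (ε c : ℂ) (M N : Submonoid.centralizer {P})
    (h : N.1 = c • M.1) :
    partDet P ε N = c ^ Module.finrank ℂ (scalarPart P ε) * partDet P ε M := by
  change LinearMap.det _ = _ * LinearMap.det _
  rw [← LinearMap.det_smul]
  congr 1
  ext v
  simp [h]

/-- For `ε = ±1` the projection `(1 + ε P) / 2` onto the `ε`-part has trace `(dim H + ε) / 2`. -/
theorem finrank_scalarPart [FiniteDimensional ℂ H] {P : Module.End ℂ H} (hP : P * P = 1)
    (htr : LinearMap.trace ℂ H P = 1) :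
    Module.finrank ℂ (scalarPart P 1) = Module.finrank ℂ (scalarPart P (-1)) + 1 := by
  have key (ε : ℂ) (hε : ε * ε = 1) : (Module.finrank ℂ (scalarPart P ε) : ℂ) =
      (2 : ℂ)⁻¹ * (Module.finrank ℂ H + ε) := by
    have hproj : LinearMap.IsProj (scalarPart P ε) ((2 : ℂ)⁻¹ • (1 + ε • P)) := by
      constructor
      · intro v
        have : P (P v) = v := LinearMap.congr_fun hP v
        rw [mem_scalarPart]
        simp only [LinearMap.smul_apply, LinearMap.add_apply, Module.End.one_apply, map_smul,
          map_add, this, smul_add, smul_smul]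
        rw [add_comm, show ε * (2⁻¹ * ε) = 2⁻¹ by linear_combination 2⁻¹ * hε,
          mul_comm ε 2⁻¹]
      · intro v hv
        rw [mem_scalarPart] at hv
        simp only [LinearMap.smul_apply, LinearMap.add_apply, Module.End.one_apply, hv, smul_smul,
          hε, one_smul]
        rw [← two_smul ℂ v, smul_smul]; norm_num
    rw [← hproj.trace]
    simp [htr, LinearMap.trace_one, mul_add]
  have h1 := key 1 (by ring)
  have h2 := key (-1) (by ring)
  have : (Module.finrank ℂ (scalarPart P 1) : ℂ) = Module.finrank ℂ (scalarPart P (-1)) + 1 := by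
    rw [h1, h2]; ring
  exact_mod_cast this

/-- A projective representation commuting with an involution of trace one lifts to a linear
representation: divide by the ratio of the determinants on the two eigenspaces, whose dimensions
differ by one. -/
theorem exists_representation_of_projective [FiniteDimensional ℂ H] {P : Module.End ℂ H}
    (hP : P * P = 1) (htr : LinearMap.trace ℂ H P = 1) {Γ : Type*} [Group Γ]
    (M : Γ → (Module.End ℂ H)ˣ) (hcomm : ∀ g, P * M g = M g * P)
    (hmul : ∀ g k, ∃ c : ℂ, (M (g * k) : Module.End ℂ H) = c • ((M g : Module.End ℂ H) * M k)) :
    ∃ ω : Representation ℂ Γ H, ∀ g, ∃ c : ℂ, c ≠ 0 ∧ ω g = c • (M g : Module.End ℂ H) := by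
  have hne : Nontrivial H := by
    by_contra h
    rw [not_nontrivial_iff_subsingleton] at h
    rw [Subsingleton.elim P 0, map_zero] at htr
    exact zero_ne_one htr
  have hmem (g : Γ) : (M g : Module.End ℂ H) ∈ Submonoid.centralizer {P} := by
    rw [Submonoid.mem_centralizer_iff]
    rintro _ rfl
    exact hcomm g
  have hmem' (g : Γ) : ((M g)⁻¹ : (Module.End ℂ H)ˣ).1 ∈ Submonoid.centralizer {P} := by
    rw [Submonoid.mem_centralizer_iff]
    rintro _ rfl
    rw [Units.eq_inv_mul_iff_mul_eq, ← mul_assoc, ← hcomm, mul_assoc, Units.mul_inv, mul_one]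
  let N (g : Γ) : Submonoid.centralizer {P} := ⟨M g, hmem g⟩
  let d (ε : ℂ) (g : Γ) : ℂ := partDet P ε (N g)
  have hd (ε : ℂ) (g : Γ) : d ε g ≠ 0 := by
    intro h
    have h1 : N g * ⟨_, hmem' g⟩ = 1 := Subtype.ext (Units.mul_inv _)
    have h2 := congrArg (partDet P ε) h1
    rw [map_mul, map_one] at h2
    change d ε g * _ = 1 at h2
    rw [h, zero_mul] at h2
    exact zero_ne_one h2
  -- Replacing `M g` by `c • M g` multiplies this ratio by `c ^ n / c ^ (n + 1) = c⁻¹`, so `r g • M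
  -- g` does not depend on the scaling.
  let r (g : Γ) : ℂ := d (-1) g / d 1 g
  have hr (g k : Γ) : r (g * k) • (M (g * k) : Module.End ℂ H) =
      (r g • (M g : Module.End ℂ H)) * (r k • (M k : Module.End ℂ H)) := by
    obtain ⟨c, hc⟩ := hmul g k
    have hc0 : c ≠ 0 := by
      rintro rfl
      rw [zero_smul] at hc
      exact (M (g * k)).ne_zero hc
    have hdet (ε : ℂ) : d ε (g * k) = c ^ Module.finrank ℂ (scalarPart P ε) * (d ε g * d ε k) := by
      change _ = _ * (partDet P ε _ * partDet P ε _)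
      rw [← map_mul]
      exact partDet_smul P ε c _ _ hc
    rw [hc, smul_smul, smul_mul_smul_comm]
    congr 1
    simp only [r, hdet, finrank_scalarPart hP htr]
    have := hd 1 g
    have := hd 1 k
    field_simp
    ring
  have hr0 (g : Γ) : r g ≠ 0 := div_ne_zero (hd _ _) (hd _ _)
  -- By `hr 1 1` this invertible operator is idempotent.
  have hone : r 1 • (M 1 : Module.End ℂ H) = 1 := by
    have h := congrArg (fun T => ((r 1)⁻¹ • ((M 1)⁻¹ : (Module.End ℂ H)ˣ).1) * T) (hr 1 1)
    simp only [mul_one, ← mul_assoc] at h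
    rw [smul_mul_smul_comm, inv_mul_cancel₀ (hr0 1), Units.inv_mul, one_smul, one_mul] at h
    exact h.symm
  refine ⟨⟨⟨fun g => r g • (M g : Module.End ℂ H), hone⟩, hr⟩, fun g => ⟨r g, hr0 g, rfl⟩⟩

end Linearization

/-! ### The Schrödinger model and its oscillator representation -/

section Schrodinger

variable {F U : Type*} [Field F] [AddCommGroup U] [Module F U]

/-- The Schrödinger model of the Heisenberg representation of `U ⊗ F²`: writing an element as
`x ⊗ e₀ + y ⊗ e₁`, it acts on functions by
`f ↦ (t ↦ ψ (z + β t y + β x y / 2) f (t + x))`. -/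
def schrodinger (h2 : (2 : F) ≠ 0) {β : LinearMap.BilinForm F U} (hβ : β.IsSymm)
    (ψ : AddChar F ℂ) : Representation ℂ (Heisenberg (tensorForm β)) (U → ℂ) where
  toFun h :=
    { toFun f t := ψ (h.ctr + β t (TensorProduct.piScalarRight F F U (Fin 2) h.vec 1) +
          2⁻¹ * β (TensorProduct.piScalarRight F F U (Fin 2) h.vec 0)
            (TensorProduct.piScalarRight F F U (Fin 2) h.vec 1)) *
          f (t + TensorProduct.piScalarRight F F U (Fin 2) h.vec 0)
      map_add' f k := by ext t; simp [mul_add]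
      map_smul' c f := by ext t; simp; ring }
  map_one' := by ext f t; simp
  map_mul' h k := by
    apply LinearMap.ext
    intro f
    ext t
    simp only [Heisenberg.mul_vec, Heisenberg.mul_ctr, map_add, Pi.add_apply, LinearMap.coe_mk,
      AddHom.coe_mk, Module.End.mul_apply, ← mul_assoc, ← AddChar.map_add_eq_mul, add_assoc t,
      tensorForm_apply, LinearMap.add_apply]
    congr 2
    rw [hβ.eq (TensorProduct.piScalarRight F F U (Fin 2) h.vec 1)
      (TensorProduct.piScalarRight F F U (Fin 2) k.vec 0)]
    field_simp
    ring

theorem schrodinger_apply (h2 : (2 : F) ≠ 0) {β : LinearMap.BilinForm F U} (hβ : β.IsSymm)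
    (ψ : AddChar F ℂ) (h : Heisenberg (tensorForm β)) (f : U → ℂ) (t : U) :
    schrodinger h2 hβ ψ h f t =
      ψ (h.ctr + β t (TensorProduct.piScalarRight F F U (Fin 2) h.vec 1) +
          2⁻¹ * β (TensorProduct.piScalarRight F F U (Fin 2) h.vec 0)
            (TensorProduct.piScalarRight F F U (Fin 2) h.vec 1)) *
          f (t + TensorProduct.piScalarRight F F U (Fin 2) h.vec 0) :=
  rfl

theorem schrodinger_isHeisenbergRep [Finite U] (h2 : (2 : F) ≠ 0) {β : LinearMap.BilinForm F U}
    (hβ : β.IsSymm) (hnd : β.SeparatingRight) {ψ : AddChar F ℂ} (hψ : ψ ≠ 1) :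
    IsHeisenbergRep ψ (schrodinger h2 hβ ψ) := by
  classical
  have := Fintype.ofFinite U
  refine ⟨?_, fun z f => ?_⟩
  · let e := TensorProduct.piScalarRight F F U (Fin 2)
    have : Nontrivial (Subrepresentation (schrodinger h2 hβ ψ)) := by
      refine ⟨⊥, ⊤, fun h => ?_⟩
      have h1 : (1 : U → ℂ) ∈ (⊥ : Subrepresentation (schrodinger h2 hβ ψ)).toSubmodule := by
        rw [h]; trivial
      have h2 : (1 : U → ℂ) = 0 := h1
      exact one_ne_zero (congrFun h2 0)
    refine ⟨fun S => or_iff_not_imp_left.2 fun hS => ?_⟩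
    obtain ⟨f, hfS, hf⟩ : ∃ f ∈ S.toSubmodule, f ≠ 0 := by
      by_contra! h
      apply hS
      ext f
      constructor
      · intro hf; exact h f hf
      · rintro rfl; exact S.toSubmodule.zero_mem
    obtain ⟨t₀, ht₀⟩ := Function.ne_iff.1 hf
    -- Averaging the modulations of `f` against `ψ (-β t₀ y)` leaves only its value at `t₀`;
    -- translations then reach every delta function.
    have hdelta₀ : Pi.single t₀ (1 : ℂ) ∈ S.toSubmodule := by
      have hmem : ((Fintype.card U : ℂ) * f t₀)⁻¹ • ∑ y, ψ (-β t₀ y) •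
          schrodinger h2 hβ ψ ⟨e.symm (Pi.single 1 y), 0⟩ f ∈ S.toSubmodule :=
        Submodule.smul_mem _ _ (Submodule.sum_mem _ fun y _ => Submodule.smul_mem _ _
          (S.apply_mem_toSubmodule _ hfS))
      convert hmem using 1
      ext t
      have hval : ∀ y, (ψ (-β t₀ y) • schrodinger h2 hβ ψ ⟨e.symm (Pi.single 1 y), 0⟩ f) t =
          ψ (β y (t - t₀)) * f t := by
        intro y
        simp only [Pi.smul_apply, schrodinger_apply, e, LinearEquiv.apply_symm_apply, smul_eq_mul,
          ← mul_assoc, ← AddChar.map_add_eq_mul, map_sub, hβ.eq y]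
        simp
        left
        congr 1
        ring
      rw [Pi.smul_apply, Finset.sum_apply, Finset.sum_congr rfl fun y _ => hval y,
        ← Finset.sum_mul]
      by_cases ht : t = t₀
      · subst ht
        have : f t ≠ 0 := ht₀
        simp
        field_simp
      · rw [AddChar.sum_bilinForm_eq_zero hψ hnd (sub_ne_zero.2 ht)]
        simp [ht]
    have hdelta (t : U) : Pi.single t (1 : ℂ) ∈ S.toSubmodule := by
      have := S.apply_mem_toSubmodule ⟨e.symm (Pi.single 0 (t₀ - t)), 0⟩ hdelta₀
      convert this using 1
      ext s
      have : s + (t₀ - t) = t₀ ↔ s = t := by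
        rw [add_sub_left_comm, add_eq_left, sub_eq_zero]
      simp [schrodinger_apply, e, Pi.single_apply, this]
    ext f
    refine ⟨fun _ => trivial, fun _ => ?_⟩
    rw [pi_eq_sum_univ' f]
    exact Submodule.sum_mem _ fun t _ => Submodule.smul_mem _ _ (by
      convert hdelta t using 1)
  · ext t
    simp [schrodinger_apply]

/-- The parity operator `f ↦ (t ↦ f (-t))`. -/
def parity (U : Type*) [AddCommGroup U] : Module.End ℂ (U → ℂ) := LinearMap.funLeft ℂ ℂ Neg.neg

theorem parity_mul_parity : parity U * parity U = 1 := by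
  ext f t
  simp [parity, LinearMap.funLeft_apply]

/-- Only `0` is fixed by negation when `2 ≠ 0`. -/
theorem trace_parity [Finite U] (h2 : (2 : F) ≠ 0) : LinearMap.trace ℂ _ (parity U) = 1 := by
  classical
  have := Fintype.ofFinite U
  rw [LinearMap.trace_eq_matrix_trace ℂ (Pi.basisFun ℂ U), Matrix.trace,
    Finset.sum_eq_single (0 : U)]
  · simp [parity, LinearMap.funLeft_apply]
  · intro t _ ht
    have : -t ≠ t := by
      intro h
      rw [neg_eq_iff_add_eq_zero, ← two_smul F, smul_eq_zero] at h
      exact h.elim h2 ht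
    simp [parity, LinearMap.funLeft_apply, this]
  · simp

theorem parity_mul_schrodinger (h2 : (2 : F) ≠ 0) {β : LinearMap.BilinForm F U} (hβ : β.IsSymm)
    (ψ : AddChar F ℂ) (w : U ⊗[F] (Fin 2 → F)) :
    parity U * schrodinger h2 hβ ψ ⟨w, 0⟩ = schrodinger h2 hβ ψ ⟨-w, 0⟩ * parity U := by
  apply LinearMap.ext
  intro f
  ext t
  simp [parity, LinearMap.funLeft_apply, schrodinger_apply, add_comm]

theorem exists_oscillatorRep [Finite F] [Finite U] (h2 : (2 : F) ≠ 0)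
    {β : LinearMap.BilinForm F U} (hβ : β.IsSymm) (hnd : β.SeparatingRight) {ψ : AddChar F ℂ}
    (hψ : ψ ≠ 1) :
    ∃ ω : Representation ℂ (Sp (tensorForm β)) (U → ℂ),
      IsOscillatorRep (schrodinger h2 hβ ψ) ω := by
  have : Finite (U ⊗[F] (Fin 2 → F)) :=
    Finite.of_equiv _ (TensorProduct.piScalarRight F F U (Fin 2)).symm.toEquiv
  have := Fintype.ofFinite (U ⊗[F] (Fin 2 → F))
  set π := schrodinger h2 hβ ψ with hπdef
  have hπ : IsHeisenbergRep ψ π := schrodinger_isHeisenbergRep h2 hβ hnd hψ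
  have halt := tensorForm_isAlt hβ
  have hB := tensorForm_separatingRight hnd
  choose M hM using hπ.exists_implementer h2 hψ halt hB
  have hMinv (g w) : ((M g)⁻¹ : (Module.End ℂ (U → ℂ))ˣ).1 * π ⟨g.1 w, 0⟩ =
      π ⟨w, 0⟩ * ((M g)⁻¹ : (Module.End ℂ (U → ℂ))ˣ).1 := by
    rw [Units.inv_mul_eq_iff_eq_mul, ← mul_assoc, hM, mul_assoc, Units.mul_inv, mul_one]
  -- Two implementers of the same symplectic map differ by an operator commuting with all Weyl
  -- operators.
  have hmul (g k) : ∃ c : ℂ, (M (g * k) : Module.End ℂ (U → ℂ)) =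
      c • ((M g : Module.End ℂ (U → ℂ)) * M k) := by
    obtain ⟨c, hc⟩ := hπ.exists_eq_smul_one
      (((M k)⁻¹ : (Module.End ℂ (U → ℂ))ˣ).1 * ((M g)⁻¹ : (Module.End ℂ (U → ℂ))ˣ).1 * M (g * k))
      fun w => by
        rw [mul_assoc, hM]
        change _ * (π ⟨g.1 (k.1 w), 0⟩ * _) = _
        rw [← mul_assoc, mul_assoc _ _ (π _), hMinv, ← mul_assoc, hMinv]
        simp only [mul_assoc]
    refine ⟨c, ?_⟩
    rw [mul_assoc, Units.inv_mul_eq_iff_eq_mul, Units.inv_mul_eq_iff_eq_mul] at hc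
    rw [hc, mul_smul_comm, mul_smul_comm, mul_one]
  -- Parity implements the central element `-1`, so its conjugate by `M g` is `c • parity U`;
  -- comparing traces, both nonzero, forces `c = 1`.
  have hcomm (g) : parity U * M g = M g * parity U := by
    obtain ⟨c, hc⟩ := hπ.exists_eq_smul_one
      (((M g)⁻¹ : (Module.End ℂ (U → ℂ))ˣ).1 * parity U * M g * parity U) fun w => by
        have h (w) : parity U * π ⟨w, 0⟩ = π ⟨-w, 0⟩ * parity U := parity_mul_schrodinger h2 hβ ψ w
        rw [mul_assoc, h, ← mul_assoc, mul_assoc _ _ (π _), hM, ← mul_assoc, mul_assoc _ _ (π _), h,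
          ← mul_assoc, ← map_neg, neg_neg, hMinv]
        simp only [mul_assoc]
    have hc' : ((M g)⁻¹ : (Module.End ℂ (U → ℂ))ˣ).1 * parity U * M g = c • parity U := by
      have := congrArg (· * parity U) hc
      simpa only [mul_assoc, parity_mul_parity, mul_one, smul_mul_assoc, one_mul] using this
    have htr := congrArg (LinearMap.trace ℂ _) hc'
    rw [LinearMap.trace_mul_comm, ← mul_assoc, Units.mul_inv, one_mul, map_smul,
      trace_parity h2, smul_eq_mul, mul_one] at htr
    rw [← htr, one_smul, mul_assoc, Units.inv_mul_eq_iff_eq_mul] at hc'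
    exact hc'
  obtain ⟨ω, hω⟩ := exists_representation_of_projective parity_mul_parity (trace_parity h2) M hcomm
    hmul
  refine ⟨ω, fun g h => ?_⟩
  obtain ⟨c, -, hc⟩ := hω g
  have hinv : ω g * ω g⁻¹ = 1 := by rw [← map_mul, mul_inv_cancel, map_one]
  have key : ω g * π h = π (spAct g h) * ω g := by
    rw [hπ.apply_eq_smul h, hπ.apply_eq_smul (spAct g h), hc, mul_smul_comm, smul_mul_assoc, hM,
      smul_mul_assoc, mul_smul_comm]
    rfl
  rw [key, mul_assoc, hinv, mul_one]

end Schrodinger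

end

theorem proposition4 {F : Type*} [Field F] [Finite F] (hF : ringChar F ≠ 2)
    {U : Type*} [AddCommGroup U] [Module F U] (hU : Module.finrank F U = 2)
    (β : LinearMap.BilinForm F U) (hsymm : β.IsSymm) (hnondeg : β.Nondegenerate)
    (ψ : AddChar F ℂ) (hψ : ψ ≠ 1) :
    (∃ (π : Representation ℂ (Heisenberg (tensorForm β)) (U → ℂ))
        (ω : Representation ℂ (Sp (tensorForm β)) (U → ℂ)),
        IsHeisenbergRep ψ π ∧ IsOscillatorRep π ω) ∧
    (∀ {H : Type*} [AddCommGroup H] [Module ℂ H]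
        (π : Representation ℂ (Heisenberg (tensorForm β)) H)
        (ω : Representation ℂ (Sp (tensorForm β)) H),
        IsHeisenbergRep ψ π → IsOscillatorRep π ω →
        intertwiningNumber (ω.comp (slToSp β)) (ω.comp (slToSp β)) = 2 * Nat.card F + 1) ∧
    (Set.range (diagOrbit (F := F))).ncard = 2 * Nat.card F + 1 := by
  have h2 : (2 : F) ≠ 0 := Ring.two_ne_zero hF
  have : FiniteDimensional F U := Module.finite_of_finrank_eq_succ hU
  have : Finite U := Module.finite_of_finite F
  have hnd : β.SeparatingRight := hnondeg.2
  refine ⟨?_, ?_, ncard_range_diagOrbit⟩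
  · obtain ⟨ω, hω⟩ := exists_oscillatorRep h2 hsymm hnd hψ
    exact ⟨_, ω, schrodinger_isHeisenbergRep h2 hsymm hnd hψ, hω⟩
  · intro H _ _ π ω hπ hω
    obtain ⟨e, he⟩ := exists_equiv_prod_plane hU β
    have : Finite (U ⊗[F] (Fin 2 → F)) := Finite.of_equiv _ e.symm
    have := Fintype.ofFinite (U ⊗[F] (Fin 2 → F))
    rw [hπ.intertwiningNumber_eq_card h2 hψ (tensorForm_isAlt hsymm)
      (tensorForm_separatingRight hnd) hω (slToSp β)
      (Q := Set.range (diagOrbit (F := F))) (fun x => ⟨diagOrbit (e x), e x, rfl⟩)]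
    · exact ncard_range_diagOrbit
    · rintro ⟨_, p, rfl⟩
      exact ⟨e.symm p, by simp⟩
    · intro x y
      rw [Subtype.ext_iff, diagOrbit_eq_iff]
      refine exists_congr fun g => ?_
      rw [← e.apply_eq_iff_eq, he, Prod.ext_iff]
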